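/- For a real number $x$ let $L(x)=x\,\log x\,\log\log x\cdots$ denote the product of $x$ and its successive iterated natural logarithms, taken over those terms that exceed $1$ (an empty product is $1$). (1) Let $T$ be a measure-preserving transformation of a measure space $(X,\mu)$, let $f\in L^1(\mu)$ be real-valued, and let $(a_n)_{n\ge1}$ be an arbitrary sequence of non-negative integers, or, if $T$ is invertible, of integers. Then $$\lim_{N\to\infty}\frac{1}{L(N)}\sum_{n=1}^N f(T^{a_n}x)=0\quad\text{for a.e. }x.$$ (2) Let $T$ be an aperiodic measure-preserving transformation (not necessarily invertible) of a probability space $(X,\mu)$ whose $\sigma$-algebra contains a countable family of sets separating the points of $X$ (for instance a standard Borel or Lebesgue probability space); aperiodic means that for a.e. $x$ one has $T^nx\ne x$ for all $n\ge1$. Let $(M_N)$ be a sequence of real numbers, positive for all large $N$, with $M_N/L(N)\to0$. Then there exist a real-valued $f\in L^1(\mu)$ and a sequence $(a_n)_{n\ge 1}$ of non-negative integers such that $$\limsup_{N\to\infty}\frac1{M_N}\sum_{n=1}^N f(T^{a_n}x)=\infty\quad\text{for a.e. }x.$$ Further, the sequence $(a_n)$ may be taken to be $(2^n)$: for every such $T$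 and $(M_N)$ there is $f\in L^1(\mu)$ with $\limsup_{N\to\infty}\frac1{M_N}\sum_{n=1}^N f(T^{2^n}x)=\infty$ for a.e. $x$. -/

import Mathlib

open MeasureTheory Filter Topology

/-- `iterLogProd x` is the product `x * log x * log (log x) * ⋯` of `x` and its iterated natural
logarithms, taken over those terms that exceed `1` (the empty product, for `x ≤ 1`, is `1`).
The terms strictly decrease as long as they exceed `1`, and no further logarithm is taken once a
term is at most `1`. -/
noncomputable def iterLogProd (x : ℝ) : ℝ :=
  open Classical in
  if h : 1 < x then x * iterLogProd (Real.log x) else 1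
termination_by ⌈x⌉₊
decreasing_by
  have h1 : Real.log x ≤ x - 1 := Real.log_le_sub_one_of_pos (by linarith)
  have h2 : ⌈Real.log x⌉₊ ≤ ⌈x - 1⌉₊ := Nat.ceil_mono h1
  have h3 : ⌈x - 1⌉₊ = ⌈x⌉₊ - 1 := Nat.ceil_sub_one x
  have h4 : 0 < ⌈x⌉₊ := Nat.ceil_pos.2 (by linarith)
  omega

/-- A transformation `T` is aperiodic (with respect to `μ`) if almost every point is not
periodic, i.e. the set of `x` with `T^n x = x` for some `n ≥ 1` is a null set. -/
def IsAperiodic {X : Type*} [MeasurableSpace X] (T : X → X) (μ : Measure X) : Prop :=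
  ∀ᵐ x ∂μ, ∀ n : ℕ, 1 ≤ n → T^[n] x ≠ x

/-! Write L for `iterLogProd` and let `logStar` be an antiderivative of 1/L. Since L(x) = x L(log x)
for x > 1, the integral of 1/L from log x to x is always 1. Both halves rest on this identity.

Convergence uses only that all the functions f ∘ S_n have the same distribution. At scale 2^k,
values of |f| up to ε L(k log 2) are harmless, values above 2^k eventually do not occur, and the sum
of those between is controlled by its mean. A value t is intermediate only when k log 2 lies between
log t and t/ε, so by the identity the relevant 1/L(k log 2) have bounded sum
(`sum_inv_iterLogProd_le`). Hence the total weight over all scales is integrable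
(`ae_eventually_dyadic_sum_le`).

For sharpness, label the levels of a Rokhlin tower of height 2^m by subsets of {0, ..., m-1} through
binary digits: T^(2^n) adds n to a label not containing n. Giving the digits weights in a group of
order R yields a set A of measure at most 1/R which most points visit along a positive proportion of
one of R prescribed disjoint blocks of exponents (`exists_frequently_visited_set`). The identity
leaves room for R blocks of length about L(2^k)/R inside dyadic intervals [2^k, 2^(k+1))
(`exists_time_blocks`). Then δR times the indicator of A has integral at most δ but sums of order δ
L(N), and Borel–Cantelli combines such functions into f. -/

/-! ### The iterated logarithm product and its reciprocal's antiderivative. -/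

theorem iterLogProd_of_one_lt {x : ℝ} (h : 1 < x) :
    iterLogProd x = x * iterLogProd (Real.log x) := by
  rw [iterLogProd]; simp [h]

theorem iterLogProd_of_le_one {x : ℝ} (h : x ≤ 1) : iterLogProd x = 1 := by
  rw [iterLogProd]; simp [not_lt.2 h]

/-- Induction along iterated logarithms. -/
theorem log_induction {p : ℝ → Prop} (h₁ : ∀ x ≤ 1, p x) (h₂ : ∀ x, 1 < x → p (Real.log x) → p x)
    (x : ℝ) : p x := by
  induction x using iterLogProd.induct with
  | case1 x h ih => exact h₂ x h ih
  | case2 x h => exact h₁ x (not_lt.1 h)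

theorem one_le_iterLogProd (x : ℝ) : 1 ≤ iterLogProd x := by
  induction x using log_induction with
  | h₁ x h => rw [iterLogProd_of_le_one h]
  | h₂ x h ih => rw [iterLogProd_of_one_lt h]; nlinarith

theorem iterLogProd_pos (x : ℝ) : 0 < iterLogProd x :=
  zero_lt_one.trans_le (one_le_iterLogProd x)

theorem le_iterLogProd (x : ℝ) : x ≤ iterLogProd x := by
  rcases le_or_gt x 1 with h | h
  · rwa [iterLogProd_of_le_one h]
  · rw [iterLogProd_of_one_lt h]
    nlinarith [one_le_iterLogProd (Real.log x)]

theorem iterLogProd_mono : Monotone iterLogProd := by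
  intro x y
  induction y using log_induction generalizing x with
  | h₁ y h =>
    intro hxy
    rw [iterLogProd_of_le_one h, iterLogProd_of_le_one (hxy.trans h)]
  | h₂ y h ih =>
    intro hxy
    rcases le_or_gt x 1 with hx | hx
    · rw [iterLogProd_of_le_one hx]; exact one_le_iterLogProd y
    · rw [iterLogProd_of_one_lt h, iterLogProd_of_one_lt hx]
      have := ih (Real.log_le_log (by linarith) hxy)
      have := iterLogProd_pos (Real.log x)
      gcongr

theorem log_sq_le {x : ℝ} (hx : 1 ≤ x) : Real.log x ^ 2 ≤ x := by
  have hy : 1 ≤ √x := Real.one_le_sqrt.2 hx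
  have h1 : Real.log x = 2 * Real.log (√x) := by
    rw [Real.log_sqrt (by linarith)]; ring
  have h2 : Real.log (√x / 2) ≤ √x / 2 - 1 := Real.log_le_sub_one_of_pos (by positivity)
  rw [Real.log_div (by positivity) (by norm_num)] at h2
  have h3 := Real.log_two_lt_d9
  have h4 : Real.log x ≤ √x := by linarith
  calc Real.log x ^ 2 ≤ √x ^ 2 := pow_le_pow_left₀ (Real.log_nonneg hx) h4 2
    _ = x := Real.sq_sqrt (by linarith)

theorem iterLogProd_le_sq {x : ℝ} (hx : 1 ≤ x) : iterLogProd x ≤ x ^ 2 := by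
  induction x using log_induction with
  | h₁ x h => rw [iterLogProd_of_le_one h]; nlinarith
  | h₂ x h ih =>
    rw [iterLogProd_of_one_lt h, sq]
    gcongr
    rcases le_or_gt (Real.log x) 1 with h' | h'
    · rw [iterLogProd_of_le_one h']; exact hx
    · exact (ih h'.le).trans (log_sq_le hx)

theorem iterLogProd_two_pow {k : ℕ} (hk : k ≠ 0) :
    iterLogProd (2 ^ k) = 2 ^ k * iterLogProd (k * Real.log 2) := by
  rw [iterLogProd_of_one_lt (one_lt_pow₀ (by norm_num) hk), Real.log_pow]

/-- The antiderivative of `1 / iterLogProd` that is the identity on `(-∞, 1]`: a smooth version of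
the iterated logarithm. -/
noncomputable def logStar (x : ℝ) : ℝ :=
  open Classical in
  if h : 1 < x then 1 + logStar (Real.log x) else x
termination_by ⌈x⌉₊
decreasing_by
  have h1 : Real.log x ≤ x - 1 := Real.log_le_sub_one_of_pos (by linarith)
  have h2 : ⌈Real.log x⌉₊ ≤ ⌈x - 1⌉₊ := Nat.ceil_mono h1
  have h3 : ⌈x - 1⌉₊ = ⌈x⌉₊ - 1 := Nat.ceil_sub_one x
  have h4 : 0 < ⌈x⌉₊ := Nat.ceil_pos.2 (by linarith)
  omega

theorem logStar_of_one_lt {x : ℝ} (h : 1 < x) : logStar x = 1 + logStar (Real.log x) := by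
  rw [logStar]; simp [h]

theorem logStar_of_le_one {x : ℝ} (h : x ≤ 1) : logStar x = x := by
  rw [logStar]; simp [not_lt.2 h]

/-- Above 1 the chain rule turns the recursion of `logStar` into that of `iterLogProd`. At 1 the
branches y and 1 + log y meet with common slope 1. -/
theorem hasDerivAt_logStar (x : ℝ) : HasDerivAt logStar (iterLogProd x)⁻¹ x := by
  induction x using log_induction with
  | h₁ x h =>
    rw [iterLogProd_of_le_one h, inv_one]
    rcases h.lt_or_eq with h | rfl
    · refine (hasDerivAt_id x).congr_of_eventuallyEq ?_
      filter_upwards [gt_mem_nhds h] with y hy using logStar_of_le_one (le_of_lt hy)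
    · have hl : HasDerivWithinAt logStar 1 (Set.Iic 1) 1 :=
        (hasDerivAt_id (1 : ℝ)).hasDerivWithinAt.congr (fun y hy => logStar_of_le_one hy)
          (logStar_of_le_one le_rfl)
      have hr : HasDerivWithinAt logStar 1 (Set.Ici 1) 1 := by
        have h1 : HasDerivAt (fun y => 1 + Real.log y) 1 1 := by
          simpa using (Real.hasDerivAt_log (one_ne_zero)).const_add 1
        refine h1.hasDerivWithinAt.congr_of_eventuallyEq ?_ (by simp [logStar_of_le_one])
        filter_upwards [self_mem_nhdsWithin, mem_nhdsWithin_of_mem_nhds (gt_mem_nhds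
          (show (1 : ℝ) < 2 by norm_num))] with y hy hy2
        rcases (show (1 : ℝ) ≤ y from hy).lt_or_eq with hy | rfl
        · rw [logStar_of_one_lt hy, logStar_of_le_one]
          have := Real.log_le_sub_one_of_pos (show 0 < y by linarith)
          have : y < 2 := hy2
          linarith
        · simp [logStar_of_le_one]
      have := hl.union hr
      rwa [Set.Iic_union_Ici, hasDerivWithinAt_univ] at this
  | h₂ x h ih =>
    rw [iterLogProd_of_one_lt h]
    have := (ih.comp x (Real.hasDerivAt_log (by linarith))).const_add 1
    rw [mul_inv_rev]
    refine this.congr_of_eventuallyEq ?_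
    filter_upwards [lt_mem_nhds h] with y hy using logStar_of_one_lt hy

theorem exists_logStar_sub_eq {x y : ℝ} (h : x ≤ y) :
    ∃ z, x ≤ z ∧ z ≤ y ∧ logStar y - logStar x = (y - x) / iterLogProd z := by
  rcases h.lt_or_eq with h | rfl
  · obtain ⟨z, hz, hz'⟩ := exists_hasDerivAt_eq_slope logStar (fun x => (iterLogProd x)⁻¹) h
      (fun z _ => (hasDerivAt_logStar z).continuousAt.continuousWithinAt)
      (fun z _ => hasDerivAt_logStar z)
    refine ⟨z, hz.1.le, hz.2.le, ?_⟩
    rw [eq_div_iff (by linarith)] at hz'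
    rw [← hz', div_eq_inv_mul]
  · exact ⟨x, le_rfl, le_rfl, by simp⟩

theorem logStar_sub_le {x y : ℝ} (h : x ≤ y) :
    logStar y - logStar x ≤ (y - x) / iterLogProd x := by
  obtain ⟨z, h1, h2, h3⟩ := exists_logStar_sub_eq h
  rw [h3]
  have := iterLogProd_pos x
  have := iterLogProd_mono h1
  have : 0 ≤ y - x := by linarith
  gcongr

theorem le_logStar_sub {x y : ℝ} (h : x ≤ y) :
    (y - x) / iterLogProd y ≤ logStar y - logStar x := by
  obtain ⟨z, h1, h2, h3⟩ := exists_logStar_sub_eq h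
  rw [h3]
  have := iterLogProd_pos z
  have := iterLogProd_mono h2
  have : 0 ≤ y - x := by linarith
  gcongr

theorem logStar_mono : Monotone logStar := fun x y h => by
  have := le_logStar_sub h
  have : 0 ≤ (y - x) / iterLogProd y := div_nonneg (by linarith) (iterLogProd_pos y).le
  linarith

theorem logStar_sub_le_sub {x y : ℝ} (h : x ≤ y) : logStar y - logStar x ≤ y - x :=
  (logStar_sub_le h).trans (div_le_self (by linarith) (one_le_iterLogProd x))

/-! ### Weights of a value across the dyadic scales. -/

open Classical in
-- The conditions force log t ≤ k log 2 < t/ε, and 1/L has integral 1 from log t to t and at most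
-- 1/ε from t to t/ε. The point is that the bound does not depend on t.
theorem sum_inv_iterLogProd_le {ε t : ℝ} (hε : 0 < ε) (ht : 0 ≤ t) (n : ℕ) :
    ∑ k ∈ Finset.range n, (if ε * iterLogProd (k * Real.log 2) < t ∧ t ≤ 2 ^ k then
      (iterLogProd (k * Real.log 2))⁻¹ else 0) ≤ (3 + ε⁻¹) / Real.log 2 := by
  have hl0 : 0 < Real.log 2 := Real.log_pos (by norm_num)
  have hl1 : Real.log 2 ≤ 1 := by have := Real.log_two_lt_d9; linarith
  -- The slack log 2 absorbs one step back from k log 2 to (k - 1) log 2, since `logStar` is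
  -- 1-Lipschitz.
  set lo := logStar (max 0 (Real.log t)) - Real.log 2 with hlo
  set hi := logStar (t / ε) with hhi
  -- Clamping to [lo, hi] gives a telescoping majorant: indices failing the conditions contribute a
  -- nonnegative increment.
  set Ψ : ℝ → ℝ := fun x => max lo (min hi (logStar x)) with hΨ
  have hΨm : Monotone Ψ := fun x y h => by
    simp only [hΨ]
    have := logStar_mono h
    gcongr
  have h0 : logStar 0 = 0 := logStar_of_le_one (by norm_num)
  have hdiff : max lo hi - lo ≤ 3 + ε⁻¹ := by
    have hε' : 0 < ε⁻¹ := inv_pos.2 hε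
    rw [sub_le_iff_le_add, max_le_iff]
    refine ⟨by linarith, ?_⟩
    rcases le_or_gt t 1 with h1 | h1
    · have h2 : max 0 (Real.log t) = 0 := max_eq_left (Real.log_nonpos ht h1)
      have h3 := logStar_sub_le_sub (show 0 ≤ t / ε by positivity)
      have h4 : t / ε ≤ ε⁻¹ := by
        rw [div_eq_mul_inv]; nlinarith
      rw [hlo, h2, h0]
      rw [h0] at h3
      linarith
    · have h2 : max 0 (Real.log t) = Real.log t := max_eq_right (Real.log_nonneg h1.le)
      have h3 := logStar_of_one_lt h1
      have h4 : logStar (t / ε) ≤ logStar t + ε⁻¹ := by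
        rcases le_total (t / ε) t with h | h
        · have := logStar_mono h; linarith
        · have h5 := logStar_sub_le h
          have h6 : (t / ε - t) / iterLogProd t ≤ ε⁻¹ := by
            rw [div_le_iff₀ (iterLogProd_pos t)]
            have := le_iterLogProd t
            calc t / ε - t ≤ ε⁻¹ * t := by rw [div_eq_inv_mul]; linarith
              _ ≤ _ := by gcongr
          linarith
      rw [hlo, h2]
      linarith
  have key : ∑ k ∈ Finset.range n, (if ε * iterLogProd (k * Real.log 2) < t ∧ t ≤ 2 ^ k then
      (iterLogProd (k * Real.log 2))⁻¹ else 0) ≤ (Ψ ((n - 1) * Real.log 2) - lo) / Real.log 2 := by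
    induction n with
    | zero =>
      simp only [Finset.range_zero, Finset.sum_empty]
      exact div_nonneg (sub_nonneg.2 (le_max_left _ _)) hl0.le
    | succ k ih =>
      rw [Finset.sum_range_succ]
      have hstep : ((k : ℝ) - 1) * Real.log 2 ≤ k * Real.log 2 := by nlinarith
      have hcast : ((k + 1 : ℕ) : ℝ) - 1 = k := by push_cast; ring
      rw [hcast]
      suffices h : (if ε * iterLogProd (k * Real.log 2) < t ∧ t ≤ 2 ^ k then
          (iterLogProd (k * Real.log 2))⁻¹ else 0) ≤
          (Ψ (k * Real.log 2) - Ψ ((k - 1) * Real.log 2)) / Real.log 2 by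
        have e : (Ψ (k * Real.log 2) - lo) / Real.log 2 = (Ψ ((k - 1) * Real.log 2) - lo) / Real.log 2
          + (Ψ (k * Real.log 2) - Ψ ((k - 1) * Real.log 2)) / Real.log 2 := by ring
        rw [e]
        exact add_le_add ih h
      split_ifs with hk
      · obtain ⟨hk1, hk2⟩ := hk
        have hc := iterLogProd_pos (k * Real.log 2)
        have htpos : 0 < t := lt_trans (by positivity) hk1
        have a1 : logStar (k * Real.log 2) ≤ hi := by
          apply logStar_mono
          rw [le_div_iff₀ hε]
          have := le_iterLogProd (k * Real.log 2)
          nlinarith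
        have a2 : max 0 (Real.log t) ≤ k * Real.log 2 := by
          refine max_le (by positivity) ?_
          rw [← Real.log_pow]
          exact Real.log_le_log htpos hk2
        have a3 := logStar_mono a2
        have a4 := logStar_sub_le_sub hstep
        have a5 := le_logStar_sub hstep
        have a6 := logStar_mono hstep
        have a7 : lo ≤ logStar ((k - 1) * Real.log 2) := by
          rw [hlo]; linarith
        have e1 : Ψ (k * Real.log 2) = logStar (k * Real.log 2) := by
          simp only [hΨ]
          rw [min_eq_right a1, max_eq_right (by linarith)]
        have e2 : Ψ ((k - 1) * Real.log 2) = logStar ((k - 1) * Real.log 2) := by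
          simp only [hΨ]
          rw [min_eq_right (by linarith), max_eq_right a7]
        rw [e1, e2, le_div_iff₀ hl0]
        refine le_trans (le_of_eq ?_) a5
        rw [div_eq_inv_mul]; ring
      · exact div_nonneg (sub_nonneg.2 (hΨm hstep)) hl0.le
  refine key.trans ?_
  gcongr
  refine le_trans (sub_le_sub_right ?_ _) hdiff
  exact max_le_max le_rfl (min_le_left _ _)

open Classical in
theorem sum_two_pow_lt_le {t : ℝ} (ht : 0 ≤ t) (n : ℕ) :
    ∑ k ∈ Finset.range n, (if (2 : ℝ) ^ k < t then (2 : ℝ) ^ (k + 1) else 0) ≤ 4 * t := by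
  induction n with
  | zero => simpa using ht
  | succ n ih =>
    rw [Finset.sum_range_succ]
    split_ifs with h
    · have h1 : ∑ k ∈ Finset.range n, (if (2 : ℝ) ^ k < t then (2 : ℝ) ^ (k + 1) else 0) ≤
          ∑ k ∈ Finset.range n, (2 : ℝ) ^ k * 2 := by
        apply Finset.sum_le_sum
        intro k _
        split_ifs
        · rw [pow_succ]
        · positivity
      rw [← Finset.sum_mul, geom_sum_eq (by norm_num)] at h1
      rw [pow_succ]
      linarith
    · simpa using ih

open Classical in
/-- The weight which a value `t` carries at the scale `2 ^ k`: values above `2 ^ k` count fully, and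
values that are negligible at this scale do not count. -/
noncomputable def scaleWeight (ε : ℝ) (k : ℕ) (t : ℝ) : ℝ :=
  if 2 ^ k < t then 1 else
    if ε * iterLogProd (k * Real.log 2) < t then
      t / (ε * (2 ^ k * iterLogProd (k * Real.log 2))) else 0

theorem measurable_scaleWeight (ε : ℝ) (k : ℕ) : Measurable (scaleWeight ε k) := by
  unfold scaleWeight
  refine Measurable.ite measurableSet_Ioi measurable_const ?_
  exact Measurable.ite measurableSet_Ioi (measurable_id.div_const _) measurable_const

theorem scaleWeight_nonneg {ε : ℝ} (hε : 0 < ε) (k : ℕ) {t : ℝ} (ht : 0 ≤ t) :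
    0 ≤ scaleWeight ε k t := by
  have := iterLogProd_pos (k * Real.log 2)
  unfold scaleWeight
  split_ifs <;> positivity

theorem sum_scaleWeight_le {ε t : ℝ} (hε : 0 < ε) (ht : 0 ≤ t) (n : ℕ) :
    ∑ k ∈ Finset.range n, 2 ^ (k + 1) * scaleWeight ε k t ≤
      (4 + 2 / ε * ((3 + ε⁻¹) / Real.log 2)) * t := by
  classical
  have h1 := sum_two_pow_lt_le ht n
  have h2 := sum_inv_iterLogProd_le hε ht n
  calc ∑ k ∈ Finset.range n, 2 ^ (k + 1) * scaleWeight ε k t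
      = ∑ k ∈ Finset.range n, ((if (2 : ℝ) ^ k < t then (2 : ℝ) ^ (k + 1) else 0) +
        2 / ε * t * (if ε * iterLogProd (k * Real.log 2) < t ∧ t ≤ 2 ^ k then
      (iterLogProd (k * Real.log 2))⁻¹ else 0)) := by
        refine Finset.sum_congr rfl fun k _ => ?_
        have := (iterLogProd_pos (k * Real.log 2)).ne'
        unfold scaleWeight
        by_cases a : (2 : ℝ) ^ k < t
        · simp [a, not_le.2 a]
        · by_cases b : ε * iterLogProd (k * Real.log 2) < t
          · simp only [a, b, not_lt.1 a, if_true, if_false, and_self]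
            field_simp
            ring
          · simp [a, b]
    _ ≤ 4 * t + 2 / ε * t * ((3 + ε⁻¹) / Real.log 2) := by
        rw [Finset.sum_add_distrib, ← Finset.mul_sum]
        gcongr
    _ = _ := by ring

/-- Total weight below 1 excludes values above 2^k and bounds the intermediate ones by ε 2^k L(k log
2) in total. The small ones, at most 2^(k+1) in number, account for the remaining 2ε. -/
theorem sum_le_of_sum_scaleWeight_lt_one {ι : Type*} {ε : ℝ} (hε : 0 < ε) {k : ℕ} {s : Finset ι}
    {v : ι → ℝ} (hv : ∀ i ∈ s, 0 ≤ v i) (hs : s.card ≤ 2 ^ (k + 1))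
    (h : ∑ i ∈ s, scaleWeight ε k (v i) < 1) :
    ∑ i ∈ s, v i ≤ 3 * ε * (2 ^ k * iterLogProd (k * Real.log 2)) := by
  set c := iterLogProd (k * Real.log 2) with hc
  have hc0 : 0 < c := iterLogProd_pos _
  have hle : ∀ i ∈ s, v i ≤ ε * (2 ^ k * c) * scaleWeight ε k (v i) + ε * c := by
    intro i hi
    have h1 : scaleWeight ε k (v i) < 1 :=
      (Finset.single_le_sum (fun j hj => scaleWeight_nonneg hε k (hv j hj)) hi).trans_lt h
    unfold scaleWeight at h1 ⊢
    rw [← hc] at *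
    split_ifs at h1 ⊢ with a b
    · exact absurd h1 (lt_irrefl _)
    · rw [mul_div_cancel₀ _ (by positivity)]
      have : 0 < ε * c := by positivity
      linarith
    · simpa using b
  calc ∑ i ∈ s, v i ≤ ∑ i ∈ s, (ε * (2 ^ k * c) * scaleWeight ε k (v i) + ε * c) :=
        Finset.sum_le_sum hle
    _ = ε * (2 ^ k * c) * ∑ i ∈ s, scaleWeight ε k (v i) + s.card * (ε * c) := by
        rw [Finset.sum_add_distrib, ← Finset.mul_sum, Finset.sum_const, nsmul_eq_mul]
    _ ≤ ε * (2 ^ k * c) * 1 + 2 ^ (k + 1) * (ε * c) := by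
        have : (s.card : ℝ) ≤ 2 ^ (k + 1) := by exact_mod_cast hs
        gcongr
    _ = _ := by ring

/-! ### Almost everywhere convergence for identically distributed functions. -/

section

variable {X : Type*} [MeasurableSpace X] {μ : Measure X}

/-- By invariance the weights summed over all scales and times have integral at most a constant
times that of h. So the series over k is finite a.e. and its terms are eventually below 1. -/
theorem ae_eventually_dyadic_sum_le {S : ℕ → X → X} (hS : ∀ n, MeasurePreserving (S n) μ μ)
    {h : X → ℝ} (hm : Measurable h) (h0 : ∀ x, 0 ≤ h x) (hi : ∫⁻ x, ENNReal.ofReal (h x) ∂μ ≠ ⊤)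
    {ε : ℝ} (hε : 0 < ε) :
    ∀ᵐ x ∂μ, ∀ᶠ k : ℕ in atTop, ∑ n ∈ Finset.Icc 1 (2 ^ (k + 1)), h (S n x) ≤
      3 * ε * (2 ^ k * iterLogProd (k * Real.log 2)) := by
  have hWm : ∀ k, Measurable fun x => ENNReal.ofReal (scaleWeight ε k (h x)) := fun k =>
    ((measurable_scaleWeight ε k).comp hm).ennreal_ofReal
  have hWmS : ∀ k n, Measurable fun x => ENNReal.ofReal (scaleWeight ε k (h (S n x))) :=
    fun k n => (hWm k).comp (hS n).measurable
  have hsumm : ∀ k, Measurable fun x => ∑ n ∈ Finset.Icc 1 (2 ^ (k + 1)),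
      ENNReal.ofReal (scaleWeight ε k (h (S n x))) := fun k =>
    Finset.measurable_fun_sum _ fun n _ => hWmS k n
  set C := 4 + 2 / ε * ((3 + ε⁻¹) / Real.log 2)
  have hC : 0 ≤ C := by
    have : 0 < Real.log 2 := Real.log_pos (by norm_num)
    positivity
  have hfin : ∫⁻ x, ∑' k : ℕ, ∑ n ∈ Finset.Icc 1 (2 ^ (k + 1)),
      ENNReal.ofReal (scaleWeight ε k (h (S n x))) ∂μ ≠ ⊤ := by
    have e : ∫⁻ x, ∑' k : ℕ, ∑ n ∈ Finset.Icc 1 (2 ^ (k + 1)),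
        ENNReal.ofReal (scaleWeight ε k (h (S n x))) ∂μ =
        ∫⁻ x, ∑' k : ℕ, ENNReal.ofReal (2 ^ (k + 1) * scaleWeight ε k (h x)) ∂μ := by
      rw [lintegral_tsum (fun k => (hsumm k).aemeasurable), lintegral_tsum]
      · refine tsum_congr fun k => ?_
        rw [lintegral_finsetSum _ (fun n _ => hWmS k n)]
        have : ∀ n, ∫⁻ x, ENNReal.ofReal (scaleWeight ε k (h (S n x))) ∂μ =
            ∫⁻ x, ENNReal.ofReal (scaleWeight ε k (h x)) ∂μ := fun n =>
          (hS n).lintegral_comp (hWm k)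
        simp_rw [this, ENNReal.ofReal_mul (show (0 : ℝ) ≤ 2 ^ (k + 1) by positivity)]
        rw [lintegral_const_mul _ (hWm k), Finset.sum_const, Nat.card_Icc, nsmul_eq_mul,
          ENNReal.ofReal_pow (by norm_num)]
        simp
      · exact fun k => (((measurable_scaleWeight ε k).comp hm).const_mul _).ennreal_ofReal.aemeasurable
    rw [e]
    refine ne_top_of_le_ne_top (b := ∫⁻ x, ENNReal.ofReal C * ENNReal.ofReal (h x) ∂μ) ?_ ?_
    · rw [lintegral_const_mul _ hm.ennreal_ofReal]
      exact ENNReal.mul_ne_top ENNReal.ofReal_ne_top hi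
    · refine lintegral_mono fun x => ENNReal.tsum_le_of_sum_range_le fun n => ?_
      rw [← ENNReal.ofReal_sum_of_nonneg, ← ENNReal.ofReal_mul hC]
      · exact ENNReal.ofReal_le_ofReal (sum_scaleWeight_le hε (h0 x) n)
      · intro k _
        have := scaleWeight_nonneg hε k (h0 x)
        positivity
  filter_upwards [ae_lt_top (Measurable.tsum hsumm) hfin] with x hx
  have ht := ENNReal.tendsto_atTop_zero_of_tsum_ne_top hx.ne
  filter_upwards [ht.eventually (gt_mem_nhds (show (0 : ENNReal) < 1 by simp))] with k hk
  refine sum_le_of_sum_scaleWeight_lt_one hε (fun n _ => h0 _) (by simp) ?_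
  rw [← ENNReal.ofReal_sum_of_nonneg (fun n _ => scaleWeight_nonneg hε k (h0 _))] at hk
  exact ENNReal.ofReal_lt_one.1 hk

/-- Partial sums of identically distributed integrable functions are `o(N log N log log N ⋯)`. -/
theorem ae_tendsto_sum_div_iterLogProd {S : ℕ → X → X}
    (hS : ∀ n, MeasurePreserving (S n) μ μ) {f : X → ℝ} (hf : Integrable f μ) :
    ∀ᵐ x ∂μ, Tendsto (fun N : ℕ => (∑ n ∈ Finset.Icc 1 N, f (S n x)) / iterLogProd (N : ℝ))
      atTop (𝓝 0) := by
  obtain ⟨g, hgm, hfg⟩ := hf.aestronglyMeasurable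
  have hg : Integrable g μ := hf.congr hfg
  have hae : ∀ᵐ x ∂μ, ∀ n, f (S n x) = g (S n x) :=
    ae_all_iff.2 fun n => (hS n).quasiMeasurePreserving.ae_eq_comp hfg
  have hgi : ∫⁻ x, ENNReal.ofReal |g x| ∂μ ≠ ⊤ := by
    have := hg.hasFiniteIntegral
    rw [hasFiniteIntegral_iff_norm] at this
    exact this.ne
  have hev : ∀ᵐ x ∂μ, ∀ m : ℕ, ∀ᶠ k : ℕ in atTop, ∑ n ∈ Finset.Icc 1 (2 ^ (k + 1)), |g (S n x)| ≤
      3 * (1 / ((m : ℝ) + 1)) * (2 ^ k * iterLogProd (k * Real.log 2)) :=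
    ae_all_iff.2 fun m => ae_eventually_dyadic_sum_le hS (h := fun x => |g x|) hgm.norm.measurable
      (fun x => abs_nonneg _) hgi Nat.one_div_pos_of_nat
  filter_upwards [hae, hev] with x hx1 hx2
  simp_rw [hx1]
  rw [Metric.tendsto_atTop']
  intro δ hδ
  obtain ⟨m, hm⟩ := exists_nat_one_div_lt (show 0 < δ / 3 by positivity)
  obtain ⟨k₀, hk₀⟩ := eventually_atTop.1 (hx2 m)
  refine ⟨2 ^ (k₀ + 1), fun N hN => ?_⟩
  have hN0 : N ≠ 0 := by
    have : 0 < 2 ^ (k₀ + 1) := by positivity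
    omega
  set k := Nat.log 2 N with hkdef
  have hk1 : 2 ^ k ≤ N := Nat.pow_log_le_self 2 hN0
  have hk2 : N < 2 ^ (k + 1) := Nat.lt_pow_succ_log_self (by norm_num) N
  have hk : k₀ + 1 ≤ k := by
    rw [hkdef]
    exact Nat.le_log_of_pow_le (by norm_num) hN.le
  have hL : 2 ^ k * iterLogProd (k * Real.log 2) ≤ iterLogProd N := by
    rw [← iterLogProd_two_pow (by omega)]
    exact iterLogProd_mono (by exact_mod_cast hk1)
  have hLN := iterLogProd_pos N
  rw [dist_zero_right, Real.norm_eq_abs, abs_div, abs_of_pos hLN, div_lt_iff₀ hLN]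
  calc |∑ n ∈ Finset.Icc 1 N, g (S n x)| ≤ ∑ n ∈ Finset.Icc 1 N, |g (S n x)| :=
        Finset.abs_sum_le_sum_abs _ _
    _ ≤ ∑ n ∈ Finset.Icc 1 (2 ^ (k + 1)), |g (S n x)| :=
        Finset.sum_le_sum_of_subset_of_nonneg (Finset.Icc_subset_Icc_right hk2.le)
          fun _ _ _ => abs_nonneg _
    _ ≤ 3 * (1 / ((m : ℝ) + 1)) * (2 ^ k * iterLogProd (k * Real.log 2)) := hk₀ k (by omega)
    _ ≤ 3 * (1 / ((m : ℝ) + 1)) * iterLogProd N := by gcongr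
    _ < δ * iterLogProd N := by gcongr; linarith

end

/-! ### Rokhlin's lemma without invertibility. -/

section

variable {X : Type*} [MeasurableSpace X] {μ : Measure X} {T : X → X}

/-- Almost every point of an aperiodic system lies in one of countably many measurable sets which
are disjoint from their first `K` preimages. -/
theorem exists_seq_disjoint_preimages [MeasurableSpace.CountablySeparated X] (hT : Measurable T)
    (ha : IsAperiodic T μ) (K : ℕ) :
    ∃ C : ℕ → Set X, (∀ l, MeasurableSet (C l)) ∧
      (∀ l d, 1 ≤ d → d ≤ K → ∀ x ∈ C l, T^[d] x ∉ C l) ∧ ∀ᵐ x ∂μ, ∃ l, x ∈ C l := by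
  obtain ⟨g, hg, hinj⟩ := MeasurableSpace.measurable_injection_nat_bool_of_countablySeparated X
  obtain ⟨e, he⟩ : ∃ e : ℕ → (Fin K → ℕ) × (Fin K → Bool), Function.Surjective e :=
    exists_surjective_nat _
  have hgm : ∀ n i, Measurable fun x => g (T^[n] x) i := fun n i =>
    (measurable_pi_apply i).comp (hg.comp (hT.iterate n))
  -- The index l encodes, for each lag, a coordinate separating x from its iterate, together with
  -- the bit of x there. The index d : `Fin K` stands for the lag d + 1.
  refine ⟨fun l => {x | ∀ d : Fin K, g (T^[0] x) ((e l).1 d) = (e l).2 d ∧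
    g (T^[d + 1] x) ((e l).1 d) ≠ (e l).2 d}, fun l => ?_, fun l d hd1 hd2 x hx hx' => ?_, ?_⟩
  · beta_reduce
    rw [Set.ofPred_forall]
    refine MeasurableSet.iInter fun d => ?_
    exact (hgm 0 _ (measurableSet_singleton _)).inter (hgm _ _ (measurableSet_singleton _)).compl
  · have h1 := (hx ⟨d - 1, by omega⟩).2
    have h2 := (hx' ⟨d - 1, by omega⟩).1
    rw [Function.iterate_zero_apply] at h2
    simp only [Nat.sub_add_cancel hd1] at h1
    exact h1 h2
  · filter_upwards [ha] with x hx
    have hsep : ∀ d : Fin K, ∃ i, g (T^[d + 1] x) i ≠ g x i := fun d => by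
      by_contra! h
      exact hx (d + 1) (by omega) (hinj (funext h))
    choose σ hσ using hsep
    obtain ⟨l, hl⟩ := he (σ, fun d => g x (σ d))
    refine ⟨l, fun d => ?_⟩
    rw [hl]
    exact ⟨rfl, hσ d⟩

theorem measure_mul_le_of_aedisjoint_preimages [IsProbabilityMeasure μ]
    (hT : MeasurePreserving T μ μ) {F : Set X} (hF : MeasurableSet F) {K : ℕ}
    (h : ∀ d, 1 ≤ d → d < K → ∀ᵐ x ∂μ, x ∈ F → T^[d] x ∉ F) : K * μ F ≤ 1 := by
  have hd : (↑(Finset.range K) : Set ℕ).Pairwise (Function.onFun (AEDisjoint μ)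
      fun i => T^[i] ⁻¹' F) := by
    have aux : ∀ i j, i < j → j < K → AEDisjoint μ (T^[i] ⁻¹' F) (T^[j] ⁻¹' F) := by
      intro i j hij hj
      have h1 := (hT.iterate i).quasiMeasurePreserving.ae (h (j - i) (by omega) (by omega))
      rw [AEDisjoint, ← compl_mem_ae_iff]
      filter_upwards [h1] with x hx hx'
      refine hx hx'.1 ?_
      rw [← Function.iterate_add_apply, Nat.sub_add_cancel hij.le]
      exact hx'.2
    intro i hi j hj hij
    simp only [Finset.coe_range, Set.mem_Iio] at hi hj
    rcases lt_or_gt_of_ne hij with h' | h'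
    · exact aux i j h' hj
    · exact (aux j i h' hi).symm
  have hm : ∀ i ∈ Finset.range K, NullMeasurableSet (T^[i] ⁻¹' F) μ := fun i _ =>
    ((hT.iterate i).measurable hF).nullMeasurableSet
  have := measure_biUnion_finset₀ hd hm
  have e : ∀ i ∈ Finset.range K, μ (T^[i] ⁻¹' F) = μ F := fun i _ =>
    (hT.iterate i).measure_preimage hF.nullMeasurableSet
  rw [Finset.sum_congr rfl e, Finset.sum_const, Finset.card_range, nsmul_eq_mul] at this
  rw [← this]
  exact prob_le_one

/-- An aperiodic system has sets of arbitrarily small measure which almost every orbit meets. -/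
theorem exists_small_sweeping_set [IsProbabilityMeasure μ] [MeasurableSpace.CountablySeparated X]
    (hT : MeasurePreserving T μ μ) (ha : IsAperiodic T μ) (K : ℕ) :
    ∃ F : Set X, MeasurableSet F ∧ K * μ F ≤ 1 ∧ ∀ᵐ x ∂μ, ∃ i, T^[i] x ∈ F := by
  obtain ⟨C, hCm, hCd, hC⟩ := exists_seq_disjoint_preimages hT.measurable ha K
  have hrec : ∀ᵐ x ∂μ, ∀ l, x ∈ C l → ∃ᶠ n in atTop, T^[n] x ∈ C l := ae_all_iff.2 fun l =>
    hT.conservative.ae_mem_imp_frequently_image_mem (hCm l).nullMeasurableSet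
  -- F collects the visits of an orbit to the `C l` of least index that it ever meets from then on.
  set F : Set X := {x | ∃ l, x ∈ C l ∧ ∀ m < l, ∀ i, T^[i] x ∉ C m} with hFdef
  have hF : MeasurableSet F := by
    have : F = ⋃ l, C l ∩ ⋂ m, ⋂ (_ : m < l), ⋂ i, (T^[i] ⁻¹' C m)ᶜ := by
      ext x; simp [hFdef]
    rw [this]
    refine MeasurableSet.iUnion fun l => (hCm l).inter ?_
    exact MeasurableSet.iInter fun m => MeasurableSet.iInter fun _ => MeasurableSet.iInter fun i =>
      (hT.measurable.iterate i (hCm m)).compl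
  refine ⟨F, hF, measure_mul_le_of_aedisjoint_preimages hT hF fun d hd1 hd2 => ?_, ?_⟩
  · filter_upwards [hrec] with x hx
    rintro ⟨l, hl, hl'⟩ ⟨m, hm, hm'⟩
    rcases lt_trichotomy m l with h | rfl | h
    · exact hl' m h d hm
    · exact hCd m d hd1 hd2.le x hl hm
    -- Poincaré recurrence: the orbit returns to `C l` after time d, so the least index cannot
    -- increase along it.
    · obtain ⟨n, hn, hn'⟩ := (frequently_atTop.1 (hx l hl)) d
      apply hm' l h (n - d)
      rwa [← Function.iterate_add_apply, Nat.sub_add_cancel hn]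
  · filter_upwards [hC] with x hx
    classical
    have hex : ∃ l, ∃ i, T^[i] x ∈ C l := ⟨hx.choose, 0, hx.choose_spec⟩
    obtain ⟨i, hi⟩ := Nat.find_spec hex
    refine ⟨i, Nat.find hex, hi, fun m hm j hj => Nat.find_min hex hm ⟨j + i, ?_⟩⟩
    rwa [Function.iterate_add_apply]

/-- **Rokhlin's lemma** for aperiodic, possibly non-invertible transformations: the sets
`T⁻ⁱ B`, `i < H`, are disjoint and cover the space up to measure `ε`. -/
theorem exists_rokhlin_tower [IsProbabilityMeasure μ] [MeasurableSpace.CountablySeparated X]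
    (hT : MeasurePreserving T μ μ) (ha : IsAperiodic T μ) {H : ℕ} (hH : 0 < H) {ε : ENNReal}
    (hε : ε ≠ 0) :
    ∃ B : Set X, MeasurableSet B ∧
      (∀ x i j, i < H → j < H → T^[i] x ∈ B → T^[j] x ∈ B → i = j) ∧
      μ {x | ∀ i < H, T^[i] x ∉ B} ≤ ε := by
  obtain ⟨K, hK⟩ : ∃ K : ℕ, H / ε < K := ENNReal.exists_nat_gt
    (ENNReal.div_ne_top (ENNReal.natCast_ne_top H) hε)
  obtain ⟨F, hF, hKF, hsw⟩ := exists_small_sweeping_set hT ha K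
  have hm : ∀ i, MeasurableSet (T^[i] ⁻¹' F) := fun i => hT.measurable.iterate i hF
  -- B consists of the points whose first hitting time of F is a positive multiple of H. Positivity
  -- makes two points of B less than H apart on an orbit share the same hit, so their distance is
  -- divisible by H. Only points hitting F before time H can be missed.
  set B : Set X := {x | ∃ a, 1 ≤ a ∧ T^[a * H] x ∈ F ∧ ∀ i < a * H, T^[i] x ∉ F} with hB
  refine ⟨B, ?_, ?_, ?_⟩
  · have : B = ⋃ a, ⋃ (_ : 1 ≤ a), T^[a * H] ⁻¹' F ∩ ⋂ i, ⋂ (_ : i < a * H), (T^[i] ⁻¹' F)ᶜ := by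
      ext x; simp [hB, and_left_comm]
    rw [this]
    exact MeasurableSet.iUnion fun a => MeasurableSet.iUnion fun _ => (hm _).inter <|
      MeasurableSet.iInter fun i => MeasurableSet.iInter fun _ => (hm i).compl
  · have aux : ∀ x i j, i < j → j < H → T^[i] x ∈ B → T^[j] x ∉ B := by
      rintro x i j hij hj ⟨a, ha1, ha2, ha3⟩ ⟨b, hb1, hb2, hb3⟩
      have haH : H ≤ a * H := Nat.le_mul_of_pos_left H ha1
      have h1 : ¬ (a * H + i - j < b * H) := fun h => by
        apply hb3 _ h
        rw [← Function.iterate_add_apply] at ha2 ⊢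
        rwa [Nat.sub_add_cancel (by omega)]
      have h2 : ¬ (b * H + j - i < a * H) := fun h => by
        apply ha3 _ h
        rw [← Function.iterate_add_apply] at hb2 ⊢
        rwa [Nat.sub_add_cancel (by omega)]
      have h3 : a * H = b * H + (j - i) := by omega
      have h4 : (a * H) % H = (b * H + (j - i)) % H := by rw [h3]
      rw [Nat.mul_mod_left, Nat.mul_comm, Nat.mul_add_mod, Nat.mod_eq_of_lt (by omega)] at h4
      omega
    intro x i j hi hj h1 h2
    rcases lt_trichotomy i j with h | h | h
    · exact absurd h2 (aux x i j h hj h1)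
    · exact h
    · exact absurd h1 (aux x j i h hi h2)
  · calc μ {x | ∀ i < H, T^[i] x ∉ B} ≤ μ (⋃ i ∈ Finset.range H, T^[i] ⁻¹' F) := by
          refine measure_mono_ae ?_
          filter_upwards [hsw] with x hx hxB
          classical
          by_contra hcon
          have hcon' : ∀ i < H, T^[i] x ∉ F := by
            intro i hi hx'
            exact hcon (Set.mem_biUnion (Finset.mem_coe.2 (Finset.mem_range.2 hi)) hx')
          set n := Nat.find hx with hn
          have hnF : T^[n] x ∈ F := Nat.find_spec hx
          have hmin : ∀ i < n, T^[i] x ∉ F := fun i hi => Nat.find_min hx hi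
          have hnH : H ≤ n := not_lt.1 fun h => hcon' n h hnF
          have hdiv : n / H * H + n % H = n := by rw [Nat.mul_comm]; exact Nat.div_add_mod n H
          refine hxB (n % H) (Nat.mod_lt _ hH) ⟨n / H, Nat.div_pos hnH hH, ?_, fun i hi => ?_⟩
          · rwa [← Function.iterate_add_apply, hdiv]
          · rw [← Function.iterate_add_apply]
            exact hmin _ (by omega)
    _ ≤ ∑ i ∈ Finset.range H, μ (T^[i] ⁻¹' F) := measure_biUnion_finset_le _ _
    _ = H * μ F := by
        rw [Finset.sum_congr rfl fun i _ => (hT.iterate i).measure_preimage hF.nullMeasurableSet]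
        simp
    _ ≤ ε := by
        rcases eq_or_ne ε ⊤ with rfl | hε'
        · exact le_top
        have h1 : (H : ENNReal) ≤ K * ε := (ENNReal.div_le_iff hε hε').1 hK.le
        calc H * μ F ≤ K * ε * μ F := by gcongr
          _ = K * μ F * ε := by ring
          _ ≤ 1 * ε := by gcongr
          _ = ε := one_mul ε

end

/-! ### Small sets visited often at times that are powers of two. -/

/-- A Chernoff bound: few subsets of `U` contain almost all of a given set `P ⊆ U`. -/
theorem card_filter_card_sdiff_le_mul_two_pow_le {U P : Finset ℕ} (hPU : P ⊆ U) {q : ℕ}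
    (hq : 8 * q ≤ P.card) :
    (U.powerset.filter fun s => (P \ s).card ≤ q).card * 2 ^ q ≤ 2 ^ U.card := by
  -- Expanding ∏ (1 + b i) over U gives the exponential moment of |P \ s|. Markov's inequality then
  -- suffices because (3/4)^8 ≤ 1/4, whence the factor 8 in `hq`.
  set b : ℕ → ℝ := fun i => if i ∈ P then 1 / 2 else 1 with hb
  have h1 : ∑ s ∈ U.powerset, (1 / 2 : ℝ) ^ (P \ s).card = 2 ^ U.card * (3 / 4) ^ P.card := by
    have e := Finset.prod_add (fun _ => (1 : ℝ)) b U
    have e1 : ∏ i ∈ U, (1 + b i) = 2 ^ U.card * (3 / 4) ^ P.card := by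
      have : ∀ i ∈ U, 1 + b i = 2 * (if i ∈ P then 3 / 4 else 1) := fun i _ => by
        simp only [hb]; split_ifs <;> norm_num
      rw [Finset.prod_congr rfl this, Finset.prod_mul_distrib, Finset.prod_const,
        Finset.prod_ite, Finset.prod_const, Finset.prod_const_one, mul_one,
        Finset.filter_mem_eq_inter, Finset.inter_eq_right.2 hPU]
    rw [← e1, e]
    refine Finset.sum_congr rfl fun s _ => ?_
    rw [Finset.prod_const_one, one_mul]
    simp only [hb]
    rw [Finset.prod_ite, Finset.prod_const, Finset.prod_const_one, mul_one,
      Finset.filter_mem_eq_inter]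
    congr 2
    ext i
    simp only [Finset.mem_sdiff, Finset.mem_inter]
    exact ⟨fun h => ⟨⟨hPU h.1, h.2⟩, h.1⟩, fun h => ⟨h.2, h.1.2⟩⟩
  have h2 : ((U.powerset.filter fun s => (P \ s).card ≤ q).card : ℝ) * (1 / 2) ^ q ≤
      2 ^ U.card * (3 / 4) ^ P.card := by
    rw [← h1, ← nsmul_eq_mul, ← Finset.sum_const]
    refine (Finset.sum_le_sum fun s hs => ?_).trans
      (Finset.sum_le_sum_of_subset_of_nonneg (Finset.filter_subset _ _) fun _ _ _ => by positivity)
    exact pow_le_pow_of_le_one (by norm_num) (by norm_num) (Finset.mem_filter.1 hs).2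
  have h3 : (3 / 4 : ℝ) ^ P.card ≤ (1 / 4) ^ q := by
    calc (3 / 4 : ℝ) ^ P.card ≤ (3 / 4) ^ (8 * q) :=
          pow_le_pow_of_le_one (by norm_num) (by norm_num) hq
      _ = ((3 / 4) ^ 8) ^ q := pow_mul _ _ _
      _ ≤ (1 / 4) ^ q := by gcongr; norm_num
  have h4 : ((U.powerset.filter fun s => (P \ s).card ≤ q).card : ℝ) * 2 ^ q ≤ 2 ^ U.card := by
    calc ((U.powerset.filter fun s => (P \ s).card ≤ q).card : ℝ) * 2 ^ q
        = (U.powerset.filter fun s => (P \ s).card ≤ q).card * (1 / 2) ^ q * 4 ^ q := by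
          rw [mul_assoc, ← mul_pow]; norm_num
      _ ≤ 2 ^ U.card * (3 / 4) ^ P.card * 4 ^ q := by gcongr
      _ ≤ 2 ^ U.card * (1 / 4) ^ q * 4 ^ q := by gcongr
      _ = 2 ^ U.card := by rw [mul_assoc, ← mul_pow]; norm_num
  exact_mod_cast h4

theorem exists_card_mul_card_fiber_le {α G : Type*} [Fintype G] [Nonempty G] [DecidableEq G]
    (s : Finset α) (φ : α → G) :
    ∃ c, Fintype.card G * (s.filter fun a => φ a = c).card ≤ s.card := by
  by_contra! h
  have h1 : s.card = ∑ c : G, (s.filter fun a => φ a = c).card :=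
    Finset.card_eq_sum_card_fiberwise fun _ _ => Finset.mem_coe.2 (Finset.mem_univ _)
  have h2 : ∑ _c : G, s.card < ∑ c : G, Fintype.card G * (s.filter fun a => φ a = c).card :=
    Finset.sum_lt_sum_of_nonempty Finset.univ_nonempty fun c _ => h c
  rw [← Finset.mul_sum, ← h1, Finset.sum_const, Finset.card_univ, smul_eq_mul] at h2
  exact lt_irrefl _ h2

section

variable {X : Type*} [MeasurableSpace X] {μ : Measure X} {T : X → X}

/-- Given disjoint sets of times `P e`, indexed by a finite group `G`, there is a set `A` of measure
at most `1 / |G|` such that most points visit `A` at a positive proportion of the times `2 ^ n`,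
`n ∈ P e`, for some `e`. -/
theorem exists_frequently_visited_set [IsProbabilityMeasure μ]
    [MeasurableSpace.CountablySeparated X] (hT : MeasurePreserving T μ μ) (ha : IsAperiodic T μ)
    {G : Type*} [AddCommGroup G] [Fintype G] {P : G → Finset ℕ} {q : G → ℕ}
    (hdisj : ∀ e e', e ≠ e' → Disjoint (P e) (P e')) (hP : ∀ e, 8 * q e ≤ (P e).card)
    {ε : ENNReal} (hε : ε ≠ 0) (hq : ∀ e, (Fintype.card G : ENNReal) ≤ ε * 2 ^ q e) :
    ∃ A : Set X, MeasurableSet A ∧ Fintype.card G * μ A ≤ 1 ∧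
      μ {x | ¬ ∃ e, ∃ s ⊆ P e, q e ≤ s.card ∧ ∀ n ∈ s, T^[2 ^ n] x ∈ A} ≤ 2 * ε := by
  classical
  obtain ⟨m, hm⟩ : ∃ m, ∀ e, P e ⊆ Finset.range m := by
    obtain ⟨m, hm⟩ := (Finset.univ.biUnion P).exists_nat_subset_range
    exact ⟨m, fun e => (Finset.subset_biUnion_of_mem P (Finset.mem_univ e)).trans hm⟩
  obtain ⟨θ, hθ⟩ : ∃ θ : ℕ → G, ∀ e, ∀ n ∈ P e, θ n = -e := by
    refine ⟨fun n => if h : ∃ e, n ∈ P e then -h.choose else 0, fun e n hn => ?_⟩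
    have h : ∃ e, n ∈ P e := ⟨e, hn⟩
    simp only [h, dif_pos]
    congr 1
    by_contra hne
    exact Finset.disjoint_left.1 (hdisj _ _ hne) h.choose_spec hn
  set φ : Finset ℕ → G := fun s => ∑ i ∈ s, θ i with hφ
  set pos : Finset ℕ → ℕ := fun s => ∑ i ∈ s, 2 ^ i with hpos
  set Λ := (Finset.range m).powerset with hΛ
  have hΛc : Λ.card = 2 ^ m := by rw [hΛ, Finset.card_powerset, Finset.card_range]
  have hposlt : ∀ s ∈ Λ, pos s < 2 ^ m := fun s hs =>
    Nat.geomSum_lt le_rfl fun i hi => Finset.mem_range.1 (Finset.mem_powerset.1 hs hi)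
  obtain ⟨c, hc⟩ := exists_card_mul_card_fiber_le Λ φ
  obtain ⟨B, hB, hBd, hBc⟩ := exists_rokhlin_tower hT ha (H := 2 ^ m) (by positivity) hε
  have hμB : (2 ^ m : ENNReal) * μ B ≤ 1 := by
    have := measure_mul_le_of_aedisjoint_preimages hT hB (K := 2 ^ m) fun d hd1 hd2 =>
      ae_of_all _ fun x hx hx' => by
        have := hBd x 0 d (by positivity) hd2 hx hx'
        omega
    exact_mod_cast this
  -- Position 2^m - 1 is B itself, and T increases the position by one. For n ∉ s, adding 2^n
  -- produces no carry and leads to the level of `insert n s`.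
  set level : Finset ℕ → Set X := fun s => T^[2 ^ m - 1 - pos s] ⁻¹' B with hlevel
  have hlm : ∀ s, MeasurableSet (level s) := fun s => hT.measurable.iterate _ hB
  have hlμ : ∀ S : Finset (Finset ℕ), μ (⋃ s ∈ S, level s) ≤ S.card * μ B := fun S => by
    refine (measure_biUnion_finset_le _ _).trans (le_of_eq ?_)
    rw [Finset.sum_congr rfl fun s _ => (hT.iterate _).measure_preimage hB.nullMeasurableSet]
    simp
  refine ⟨⋃ s ∈ Λ.filter fun s => φ s = c, level s,
    Finset.measurableSet_biUnion _ fun s _ => hlm s, ?_, ?_⟩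
  · calc Fintype.card G * μ (⋃ s ∈ Λ.filter fun s => φ s = c, level s)
        ≤ Fintype.card G * ((Λ.filter fun s => φ s = c).card * μ B) := by gcongr; exact hlμ _
      _ = ((Fintype.card G * (Λ.filter fun s => φ s = c).card : ℕ) : ENNReal) * μ B := by
          push_cast; ring
      _ ≤ ((2 ^ m : ℕ) : ENNReal) * μ B := by gcongr; exact hc.trans_eq hΛc
      _ ≤ 1 := by exact_mod_cast hμB
  set bad : G → Finset (Finset ℕ) := fun e => Λ.filter fun s => (P e \ s).card ≤ q e with hbad
  have hsub : {x | ¬ ∃ e, ∃ s ⊆ P e, q e ≤ s.card ∧ ∀ n ∈ s,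
      T^[2 ^ n] x ∈ ⋃ s ∈ Λ.filter fun s => φ s = c, level s} ⊆
      {x | ∀ i < 2 ^ m, T^[i] x ∉ B} ∪ ⋃ e ∈ (Finset.univ : Finset G), ⋃ s ∈ bad e, level s := by
    intro x hx
    by_contra hcon
    rw [Set.mem_union, not_or] at hcon
    obtain ⟨hcon1, hcon2⟩ := hcon
    simp only [Set.mem_ofPred_eq, not_forall, not_not] at hcon1
    obtain ⟨i, hi, hxi⟩ := hcon1
    obtain ⟨s, hs⟩ : ∃ s, pos s = 2 ^ m - 1 - i :=
      ⟨(2 ^ m - 1 - i).bitIndices.toFinset, Finset.sum_toFinset_bitIndices_two_pow _⟩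
    have hsΛ : s ∈ Λ := by
      rw [hΛ, Finset.mem_powerset]
      intro j hj
      rw [Finset.mem_range]
      have h1 : 2 ^ j ≤ pos s := Finset.single_le_sum (f := fun i => 2 ^ i) (by simp) hj
      exact (Nat.pow_lt_pow_iff_right (by norm_num : 1 < 2)).1 (by omega)
    have hxs : x ∈ level s := by
      simp only [hlevel, Set.mem_preimage]
      rwa [show 2 ^ m - 1 - pos s = i by omega]
    -- The right block for level s is e = φ s - c: adding n ∈ P e to s changes φ by -e, hence lands
    -- on c and in A.
    have hgood : q (φ s - c) ≤ (P (φ s - c) \ s).card := by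
      by_contra hlt
      refine hcon2 (Set.mem_biUnion (Finset.mem_coe.2 (Finset.mem_univ (φ s - c))) ?_)
      refine Set.mem_biUnion (Finset.mem_coe.2 (Finset.mem_filter.2 ⟨hsΛ, ?_⟩)) hxs
      omega
    refine hx ⟨φ s - c, P (φ s - c) \ s, Finset.sdiff_subset, hgood, fun n hn => ?_⟩
    obtain ⟨hnP, hns⟩ := Finset.mem_sdiff.1 hn
    have hins : insert n s ∈ Λ := by
      rw [hΛ, Finset.mem_powerset, Finset.insert_subset_iff]
      exact ⟨hm _ hnP, Finset.mem_powerset.1 hsΛ⟩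
    have hpi : pos (insert n s) = 2 ^ n + pos s := Finset.sum_insert hns
    have hlt := hposlt _ hins
    refine Set.mem_biUnion (Finset.mem_coe.2 (Finset.mem_filter.2 ⟨hins, ?_⟩)) ?_
    · have h1 : φ (insert n s) = θ n + φ s := Finset.sum_insert hns
      rw [h1, hθ _ n hnP]
      abel
    · simp only [hlevel, Set.mem_preimage]
      rw [← Function.iterate_add_apply]
      rwa [show 2 ^ m - 1 - pos (insert n s) + 2 ^ n = i by omega]
  have hG0 : (Fintype.card G : ENNReal) ≠ 0 := by
    exact_mod_cast Fintype.card_ne_zero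
  have hbade : ∀ e, μ (⋃ s ∈ bad e, level s) ≤ ε / Fintype.card G := fun e => by
    refine (hlμ _).trans ?_
    rw [ENNReal.le_div_iff_mul_le (Or.inl hG0) (Or.inl (ENNReal.natCast_ne_top _))]
    have h1 := card_filter_card_sdiff_le_mul_two_pow_le (hm e) (hP e)
    rw [Finset.card_range] at h1
    calc ((bad e).card : ENNReal) * μ B * Fintype.card G
        ≤ (bad e).card * μ B * (ε * 2 ^ q e) := by gcongr; exact hq e
      _ = (((bad e).card * 2 ^ q e : ℕ) : ENNReal) * μ B * ε := by push_cast; ring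
      _ ≤ ((2 ^ m : ℕ) : ENNReal) * μ B * ε := by gcongr
      _ ≤ 1 * ε := by gcongr; exact_mod_cast hμB
      _ = ε := one_mul ε
  calc _ ≤ _ := measure_mono hsub
    _ ≤ ε + ∑ e : G, μ (⋃ s ∈ bad e, level s) :=
        (measure_union_le _ _).trans (add_le_add hBc (measure_biUnion_finset_le _ _))
    _ ≤ ε + ∑ _e : G, ε / Fintype.card G :=
        add_le_add le_rfl (Finset.sum_le_sum fun e _ => hbade e)
    _ = 2 * ε := by
        rw [Finset.sum_const, Finset.card_univ, nsmul_eq_mul,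
          ENNReal.mul_div_cancel hG0 (ENNReal.natCast_ne_top _), two_mul]

end

/-! ### Choice of the blocks of times. -/

theorem logStar_sub_le_sum_Ico {a b : ℕ} (hab : a ≤ b) :
    logStar (b + 1) - logStar (a + 1) ≤ ∑ k ∈ Finset.Ico a b, (iterLogProd ((k : ℝ) + 1))⁻¹ := by
  induction b, hab using Nat.le_induction with
  | base => simp
  | succ b hab ih =>
    rw [Finset.sum_Ico_succ_top hab]
    have := logStar_sub_le (show (b : ℝ) + 1 ≤ b + 1 + 1 by linarith)
    rw [add_sub_cancel_left, one_div] at this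
    push_cast
    linarith

theorem eventually_logStar_sub_le_half :
    ∀ᶠ w : ℕ in atTop, logStar (6 * w) - logStar (w * Real.log 2) ≤ 1 / 2 := by
  have hl0 := Real.log_two_gt_d9
  have hl1 := Real.log_two_lt_d9
  have h1 : Tendsto (fun w : ℕ => Real.log (w * Real.log 2)) atTop atTop :=
    Real.tendsto_log_atTop.comp
      (tendsto_natCast_atTop_atTop.atTop_mul_const (by linarith))
  filter_upwards [h1.eventually_ge_atTop 18, eventually_ge_atTop 2] with w hw hw2
  have hw2' : (2 : ℝ) ≤ w := by exact_mod_cast hw2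
  have h2 : 1 < w * Real.log 2 := by nlinarith
  have h3 : w * Real.log 2 ≤ 6 * w := by nlinarith
  rw [logStar_of_one_lt h2, logStar_of_one_lt (show (1 : ℝ) < 6 * w by linarith)]
  have h4 := logStar_sub_le (Real.log_le_log (by linarith) h3)
  have h5 : Real.log (6 * w) - Real.log (w * Real.log 2) ≤ 9 := by
    rw [← Real.log_div (by positivity) (by positivity)]
    have e : 6 * (w : ℝ) / (w * Real.log 2) = 6 / Real.log 2 := by
      field_simp
    rw [e]
    refine (Real.log_le_sub_one_of_pos (by positivity)).trans ?_
    rw [sub_le_iff_le_add, div_le_iff₀ (by linarith)]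
    linarith
  have h6 : 18 ≤ iterLogProd (Real.log (w * Real.log 2)) := hw.trans (le_iterLogProd _)
  have h7 : (Real.log (6 * w) - Real.log (w * Real.log 2)) /
      iterLogProd (Real.log (w * Real.log 2)) ≤ 1 / 2 := by
    rw [div_le_iff₀ (iterLogProd_pos _)]
    linarith
  linarith

/-- Here `logStar (2 ^ w)` exceeds `logStar (w * log 2)` by exactly 1, and replacing w log 2 by 6w
costs at most 1/2. -/
theorem eventually_half_le_sum_Ico :
    ∀ᶠ w : ℕ in atTop,
      1 / 2 ≤ ∑ k ∈ Finset.Ico (5 * w) (2 ^ w), (iterLogProd ((k : ℝ) + 1))⁻¹ := by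
  filter_upwards [eventually_logStar_sub_le_half, eventually_ge_atTop 5] with w hw hw5
  have h1 : 5 * w ≤ 2 ^ w := by
    clear hw
    induction w, hw5 using Nat.le_induction with
    | base => norm_num
    | succ w h ih => rw [pow_succ]; omega
  have h2 := logStar_sub_le_sum_Ico h1
  push_cast at h2
  have h3 : logStar (5 * w + 1) ≤ logStar (6 * w) := by
    apply logStar_mono
    have : (5 : ℝ) ≤ w := by exact_mod_cast hw5
    linarith
  have h4 : logStar (2 ^ w) ≤ logStar (2 ^ w + 1) := logStar_mono (by linarith)
  have h5 := logStar_of_one_lt (show (1 : ℝ) < 2 ^ w from one_lt_pow₀ (by norm_num) (by omega))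
  rw [Real.log_pow] at h5
  linarith

/-- Each [2^k, 2^(k+1)) is cut into consecutive blocks of length 8 q k; the hypothesis says that
there are at least R of them in all. -/
theorem exists_blocks_of_card {S : Finset ℕ} {q : ℕ → ℕ} {R : ℕ} [NeZero R]
    (hR : R ≤ ∑ k ∈ S, 2 ^ k / (8 * q k)) :
    ∃ (P : ZMod R → Finset ℕ) (κ : ZMod R → ℕ), (∀ e e', e ≠ e' → Disjoint (P e) (P e')) ∧
      ∀ e, κ e ∈ S ∧ (P e).card = 8 * q (κ e) ∧ P e ⊆ Finset.Ico (2 ^ κ e) (2 ^ (κ e + 1)) := by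
  set I := Σ k : S, Fin (2 ^ (k : ℕ) / (8 * q k)) with hI
  have hcard : Fintype.card (ZMod R) ≤ Fintype.card I := by
    rw [ZMod.card, Fintype.card_sigma]
    simp only [Fintype.card_fin]
    rwa [Finset.sum_coe_sort S fun k => 2 ^ k / (8 * q k)]
  obtain ⟨ι⟩ := Function.Embedding.nonempty_of_card_le hcard
  set Q : I → Finset ℕ := fun x => Finset.Ico (2 ^ (x.1 : ℕ) + 8 * q x.1 * x.2)
    (2 ^ (x.1 : ℕ) + 8 * q x.1 * (x.2 + 1)) with hQ
  have hsub : ∀ x, Q x ⊆ Finset.Ico (2 ^ (x.1 : ℕ)) (2 ^ ((x.1 : ℕ) + 1)) := fun x => by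
    refine Finset.Ico_subset_Ico (Nat.le_add_right _ _) ?_
    have h1 : 8 * q x.1 * (x.2 + 1) ≤ 2 ^ (x.1 : ℕ) :=
      (Nat.mul_le_mul_left _ x.2.isLt).trans (Nat.mul_div_le _ _)
    rw [pow_succ]
    omega
  have hdisj : ∀ x y, x ≠ y → Disjoint (Q x) (Q y) := by
    intro x y hxy
    refine Finset.disjoint_left.2 fun n hnx hny => hxy ?_
    have h1 := Finset.mem_Ico.1 (hsub x hnx)
    have h2 := Finset.mem_Ico.1 (hsub y hny)
    have h3 : (x.1 : ℕ) = y.1 :=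
      (Nat.log_eq_of_pow_le_of_lt_pow h1.1 h1.2).symm.trans
        (Nat.log_eq_of_pow_le_of_lt_pow h2.1 h2.2)
    obtain ⟨a, i⟩ := x
    obtain ⟨b, j⟩ := y
    obtain rfl : a = b := Subtype.ext h3
    have h4 := Finset.mem_Ico.1 hnx
    have h5 := Finset.mem_Ico.1 hny
    simp only at h4 h5
    have h6 : 8 * q a * (i : ℕ) < 8 * q a * (j + 1) := by omega
    have h7 : 8 * q a * (j : ℕ) < 8 * q a * (i + 1) := by omega
    have h8 := lt_of_mul_lt_mul_left h6 (Nat.zero_le _)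
    have h9 := lt_of_mul_lt_mul_left h7 (Nat.zero_le _)
    have : i = j := Fin.ext (by omega)
    rw [this]
  refine ⟨fun e => Q (ι e), fun e => (ι e).1, fun e e' h => hdisj _ _ (ι.injective.ne h),
    fun e => ⟨(ι e).1.2, ?_, hsub _⟩⟩
  simp only [hQ, Nat.card_Ico]
  rw [Nat.mul_add, mul_one]
  omega

theorem exists_time_blocks {M : ℕ → ℝ}
    (hM : Tendsto (fun N : ℕ => M N / iterLogProd (N : ℝ)) atTop (𝓝 0))
    {δ K ε : ℝ} (hδ : 0 < δ) (hK : 0 < K) (hε : 0 < ε) (N₀ : ℕ) :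
    ∃ (R : ℕ) (_ : NeZero R) (P : ZMod R → Finset ℕ) (q N : ZMod R → ℕ),
      (∀ e e', e ≠ e' → Disjoint (P e) (P e')) ∧ (∀ e, 8 * q e ≤ (P e).card) ∧
      (∀ e, (R : ℝ) ≤ ε * 2 ^ q e) ∧
      ∀ e, P e ⊆ Finset.Icc 1 (N e) ∧ N₀ ≤ N e ∧ K * M (N e) ≤ q e * (δ * R) := by
  obtain ⟨N₁, hN₁⟩ := eventually_atTop.1
    (hM.eventually (gt_mem_nhds (show 0 < δ / (128 * K) by positivity)))
  have hpow : Tendsto (fun w : ℕ => (2 : ℝ) ^ w) atTop atTop :=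
    tendsto_pow_atTop_atTop_of_one_lt (by norm_num)
  obtain ⟨w, hsum, hw2, hwN, hwε⟩ := (eventually_half_le_sum_Ico.and <|
    (eventually_ge_atTop 2).and <| (eventually_ge_atTop (max N₀ N₁)).and <|
      hpow.eventually_ge_atTop (64 / ε)).exists
  -- With R = 4^w, a k visits of height δR add up to at least δ L(2^(k+1))/128, which dominates K M.
  -- Starting at k = 5w makes a k ≥ 8^w/64, large compared with R; stopping at 2^w keeps L(k+1) ≤ R,
  -- so rounding down the number of blocks is harmless.
  set a : ℕ → ℝ := fun k => 2 ^ k * iterLogProd ((k : ℝ) + 1) / (64 * 4 ^ w) with ha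
  set q : ℕ → ℕ := fun k => ⌈a k⌉₊ with hq
  have ha8 : ∀ k, 5 * w ≤ k → 8 ^ w / 64 ≤ a k := fun k hk => by
    simp only [ha]
    rw [div_le_div_iff₀ (by norm_num) (by positivity)]
    have h1 : (32 : ℝ) ^ w ≤ 2 ^ k := by
      calc (32 : ℝ) ^ w = 2 ^ (5 * w) := by rw [pow_mul]; norm_num
        _ ≤ 2 ^ k := pow_le_pow_right₀ (by norm_num) hk
    have h2 := one_le_iterLogProd ((k : ℝ) + 1)
    calc (8 : ℝ) ^ w * (64 * 4 ^ w) = 32 ^ w * 1 * 64 := by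
          rw [show (32 : ℝ) = 8 * 4 by norm_num, mul_pow]; ring
      _ ≤ 2 ^ k * iterLogProd ((k : ℝ) + 1) * 64 := by gcongr
  have ha1 : ∀ k, 5 * w ≤ k → 1 ≤ a k := fun k hk => by
    refine le_trans ?_ (ha8 k hk)
    rw [le_div_iff₀ (by norm_num)]
    calc (1 : ℝ) * 64 = 8 ^ 2 := by norm_num
      _ ≤ 8 ^ w := pow_le_pow_right₀ (by norm_num) hw2
  have hqa : ∀ k, a k ≤ q k := fun k => Nat.le_ceil _
  have hq0 : ∀ k ∈ Finset.Ico (5 * w) (2 ^ w), 0 < q k := fun k hk =>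
    Nat.ceil_pos.2 (zero_lt_one.trans_le (ha1 k (Finset.mem_Ico.1 hk).1))
  have hq2 : ∀ k, 5 * w ≤ k → (q k : ℝ) ≤ 2 * a k := fun k hk => by
    have h1 := ha1 k hk
    have h2 := Nat.ceil_lt_add_one (show 0 ≤ a k by linarith)
    simp only [hq]
    linarith
  have hR : 4 ^ w ≤ ∑ k ∈ Finset.Ico (5 * w) (2 ^ w), 2 ^ k / (8 * q k) := by
    have h1 : ∀ k ∈ Finset.Ico (5 * w) (2 ^ w),
        2 * 4 ^ w * (iterLogProd ((k : ℝ) + 1))⁻¹ ≤ ((2 ^ k / (8 * q k) : ℕ) : ℝ) := by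
      intro k hk
      obtain ⟨hk1, hk2⟩ := Finset.mem_Ico.1 hk
      set c := iterLogProd ((k : ℝ) + 1) with hc
      have hc0 : 0 < c := iterLogProd_pos _
      have hcR : c ≤ 4 ^ w := by
        have h2 : (k : ℝ) + 1 ≤ 2 ^ w := by exact_mod_cast hk2
        calc c ≤ ((k : ℝ) + 1) ^ 2 := iterLogProd_le_sq (by linarith [Nat.cast_nonneg (α := ℝ) k])
          _ ≤ (2 ^ w) ^ 2 := by gcongr
          _ = 4 ^ w := by rw [← pow_mul, mul_comm, pow_mul]; norm_num
      have hqpos : (0 : ℝ) < q k := by exact_mod_cast hq0 k hk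
      have h3 : 4 * 4 ^ w / c ≤ (2 : ℝ) ^ k / (8 * q k) := by
        rw [div_le_div_iff₀ hc0 (by positivity)]
        have h4 := hq2 k hk1
        simp only [ha] at h4
        rw [← hc, mul_div_assoc', le_div_iff₀ (by positivity)] at h4
        linarith
      have h5 : (2 : ℝ) ^ k / (8 * q k) < ((2 ^ k / (8 * q k) : ℕ) : ℝ) + 1 := by
        rw [div_lt_iff₀ (by positivity)]
        have := Nat.lt_mul_div_succ (2 ^ k) (show 0 < 8 * q k by have := hq0 k hk; omega)
        have h6 : ((2 ^ k : ℕ) : ℝ) < ((8 * q k * (2 ^ k / (8 * q k) + 1) : ℕ) : ℝ) := by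
          exact_mod_cast this
        rw [mul_comm]
        push_cast at h6 ⊢
        exact h6
      have h7 : (1 : ℝ) ≤ 4 ^ w / c := by rwa [one_le_div hc0]
      have h8 : 4 * 4 ^ w / c = 4 * (4 ^ w / c) := by ring
      have h9 : 2 * 4 ^ w * c⁻¹ = 2 * (4 ^ w / c) := by ring
      rw [h9]
      linarith
    have h2 := Finset.sum_le_sum h1
    rw [← Finset.mul_sum] at h2
    have h3 : (4 : ℝ) ^ w ≤ ∑ k ∈ Finset.Ico (5 * w) (2 ^ w), ((2 ^ k / (8 * q k) : ℕ) : ℝ) := by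
      refine le_trans ?_ h2
      calc (4 : ℝ) ^ w = 2 * 4 ^ w * (1 / 2) := by ring
        _ ≤ _ := by gcongr
    exact_mod_cast h3
  have hne : NeZero (4 ^ w) := ⟨by positivity⟩
  obtain ⟨P, κ, hdisj, hP⟩ := exists_blocks_of_card hR
  refine ⟨4 ^ w, hne, P, fun e => q (κ e), fun e => 2 ^ (κ e + 1), hdisj, fun e => (hP e).2.1.ge,
    fun e => ?_, fun e => ?_⟩
  · have hk := (Finset.mem_Ico.1 (hP e).1).1
    have h1 : (8 : ℝ) ^ w / 64 ≤ 2 ^ q (κ e) :=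
      calc (8 : ℝ) ^ w / 64 ≤ a (κ e) := ha8 _ hk
        _ ≤ q (κ e) := hqa _
        _ ≤ 2 ^ q (κ e) := by exact_mod_cast Nat.lt_two_pow_self.le
    rw [div_le_iff₀ hε] at hwε
    push_cast
    calc (4 : ℝ) ^ w = ε * (4 ^ w * 64 / ε / 64) := by field_simp
      _ ≤ ε * (8 ^ w / 64) := by
        gcongr
        rw [div_le_iff₀ hε, show (8 : ℝ) = 4 * 2 by norm_num, mul_pow]
        nlinarith [show (0 : ℝ) < 4 ^ w by positivity]
      _ ≤ ε * 2 ^ q (κ e) := by gcongr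
  · have hk := (Finset.mem_Ico.1 (hP e).1).1
    have hN : max N₀ N₁ ≤ 2 ^ (κ e + 1) :=
      calc max N₀ N₁ ≤ κ e + 1 := by omega
        _ ≤ 2 ^ (κ e + 1) := Nat.lt_two_pow_self.le
    refine ⟨fun n hn => ?_, (le_max_left _ _).trans hN, ?_⟩
    · have h1 := Finset.mem_Ico.1 ((hP e).2.2 hn)
      exact Finset.mem_Icc.2 ⟨Nat.one_le_two_pow.trans h1.1, h1.2.le⟩
    · have h1 := hN₁ _ ((le_max_right _ _).trans hN)
      rw [div_lt_iff₀ (iterLogProd_pos _)] at h1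
      push_cast at h1 ⊢
      rw [iterLogProd_two_pow (by omega)] at h1
      have h2 : iterLogProd (((κ e + 1 : ℕ) : ℝ) * Real.log 2) ≤ iterLogProd ((κ e : ℝ) + 1) := by
        apply iterLogProd_mono
        push_cast
        have := Real.log_two_lt_d9
        exact mul_le_of_le_one_right (by positivity) (by linarith)
      calc K * M (2 ^ (κ e + 1))
          ≤ K * (δ / (128 * K) * (2 ^ (κ e + 1) * iterLogProd ((κ e : ℝ) + 1))) := by
            gcongr
            exact h1.le.trans (by gcongr)
        _ = a (κ e) * (δ * 4 ^ w) := by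
            simp only [ha]
            rw [pow_succ]
            field_simp
            ring
        _ ≤ q (κ e) * (δ * 4 ^ w) := by gcongr; exact hqa _

/-! ### Construction of the divergent function. -/

section

variable {X : Type*} [MeasurableSpace X] {μ : Measure X} {T : X → X}

theorem exists_large_sums_off_small_set [IsProbabilityMeasure μ]
    [MeasurableSpace.CountablySeparated X] (hT : MeasurePreserving T μ μ) (ha : IsAperiodic T μ)
    {M : ℕ → ℝ} (hM : Tendsto (fun N : ℕ => M N / iterLogProd (N : ℝ)) atTop (𝓝 0))
    {δ K ε : ℝ} (hδ : 0 < δ) (hK : 0 < K) (hε : 0 < ε) (N₀ : ℕ) :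
    ∃ g : X → ℝ, Measurable g ∧ (∀ x, 0 ≤ g x) ∧
      ∫⁻ x, ENNReal.ofReal (g x) ∂μ ≤ ENNReal.ofReal δ ∧
      μ {x | ¬ ∃ N ≥ N₀, K * M N ≤ ∑ n ∈ Finset.Icc 1 N, g (T^[2 ^ n] x)} ≤
        2 * ENNReal.ofReal ε := by
  classical
  obtain ⟨R, hR, P, q, N, hdisj, hP, hq, hN⟩ := exists_time_blocks hM hδ hK hε N₀
  have hR0 : (0 : ℝ) < R := by exact_mod_cast Nat.pos_of_ne_zero hR.out
  have hq' : ∀ e, (Fintype.card (ZMod R) : ENNReal) ≤ ENNReal.ofReal ε * 2 ^ q e := fun e => by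
    have := ENNReal.ofReal_le_ofReal (hq e)
    rw [ENNReal.ofReal_mul hε.le, ENNReal.ofReal_pow (by norm_num)] at this
    simpa [ZMod.card] using this
  obtain ⟨A, hA, hAμ, hbad⟩ := exists_frequently_visited_set hT ha hdisj hP
    (ENNReal.ofReal_pos.2 hε).ne' hq'
  have hv : 0 ≤ δ * R := by positivity
  have h0 : ∀ x, 0 ≤ A.indicator (fun _ => δ * R) x := fun x =>
    Set.indicator_nonneg (fun _ _ => hv) x
  refine ⟨A.indicator fun _ => δ * R, measurable_const.indicator hA, h0, ?_,
    (measure_mono ?_).trans hbad⟩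
  · have e : ∀ x, ENNReal.ofReal (A.indicator (fun _ => δ * R) x) =
        A.indicator (fun _ => ENNReal.ofReal (δ * R)) x := fun x => by
      by_cases hx : x ∈ A <;> simp [hx]
    simp_rw [e]
    rw [lintegral_indicator_const hA, ENNReal.ofReal_mul hδ.le, ENNReal.ofReal_natCast, mul_assoc]
    rw [ZMod.card] at hAμ
    exact mul_le_of_le_one_right' hAμ
  · rintro x hx ⟨e, s, hs, hqs, hsA⟩
    obtain ⟨hP1, hN0, hKM⟩ := hN e
    refine hx ⟨N e, hN0, hKM.trans ?_⟩
    calc (q e : ℝ) * (δ * R) ≤ s.card * (δ * R) := by gcongr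
      _ = ∑ n ∈ s, A.indicator (fun _ => δ * R) (T^[2 ^ n] x) := by
        rw [Finset.sum_congr rfl fun n hn => Set.indicator_of_mem (hsA n hn) _]
        simp
      _ ≤ _ := Finset.sum_le_sum_of_subset_of_nonneg (hs.trans hP1) fun _ _ _ => h0 _

theorem exists_limsup_sum_two_pow_eq_top [IsProbabilityMeasure μ]
    [MeasurableSpace.CountablySeparated X] (hT : MeasurePreserving T μ μ) (ha : IsAperiodic T μ)
    {M : ℕ → ℝ} (hM0 : ∀ᶠ N in atTop, 0 < M N)
    (hM : Tendsto (fun N : ℕ => M N / iterLogProd (N : ℝ)) atTop (𝓝 0)) :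
    ∃ f : X → ℝ, Integrable f μ ∧ ∀ᵐ x ∂μ, limsup
      (fun N : ℕ => (((∑ n ∈ Finset.Icc 1 N, f (T^[2 ^ n] x)) / M N : ℝ) : EReal)) atTop = ⊤ := by
  have hhalf : ∀ j : ℕ, (0 : ℝ) < (1 / 2) ^ j := fun j => by positivity
  -- Integrals and exceptional measures of order 2^(-j) are summable, while the factor K = j + 1
  -- tends to infinity.
  choose g hgm hg0 hgi hgb using fun j : ℕ =>
    exists_large_sums_off_small_set hT ha hM (hhalf j) (Nat.cast_add_one_pos (α := ℝ) j) (hhalf j) j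
  have hgeom : ∑' j : ℕ, ENNReal.ofReal ((1 / 2) ^ j) ≠ ⊤ := by
    rw [← ENNReal.ofReal_tsum_of_nonneg (fun j => (hhalf j).le) summable_geometric_two]
    exact ENNReal.ofReal_ne_top
  set G : X → ENNReal := fun x => ∑' j, ENNReal.ofReal (g j x) with hG
  have hGm : Measurable G := Measurable.tsum fun j => (hgm j).ennreal_ofReal
  have hGi : ∫⁻ x, G x ∂μ ≠ ⊤ := by
    rw [hG, lintegral_tsum fun j => (hgm j).ennreal_ofReal.aemeasurable]
    exact ne_top_of_le_ne_top hgeom (ENNReal.tsum_le_tsum hgi)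
  refine ⟨fun x => (G x).toReal, integrable_toReal_of_lintegral_ne_top hGm.aemeasurable hGi, ?_⟩
  -- Finiteness along the orbit is needed because `toReal` sends ⊤ to 0, which would destroy the
  -- bound g j ≤ f.
  have hfin : ∀ᵐ x ∂μ, ∀ n : ℕ, G (T^[2 ^ n] x) < ⊤ := ae_all_iff.2 fun n =>
    (hT.iterate _).quasiMeasurePreserving.ae (ae_lt_top hGm hGi)
  have hbc := ae_eventually_notMem (μ := μ)
    (s := fun j => {x | ¬ ∃ N ≥ j, ((j : ℝ) + 1) * M N ≤ ∑ n ∈ Finset.Icc 1 N, g j (T^[2 ^ n] x)})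
    (by
      refine ne_top_of_le_ne_top ?_ (ENNReal.tsum_le_tsum hgb)
      rw [ENNReal.tsum_mul_left]
      exact ENNReal.mul_ne_top (by simp) hgeom)
  filter_upwards [hfin, hbc] with x hx hxj
  rw [EReal.eq_top_iff_forall_lt]
  intro c
  have hc : ((c : ℝ) : EReal) < ((c + 1 : ℝ) : EReal) := by exact_mod_cast lt_add_one c
  refine hc.trans_le (le_limsup_of_frequently_le (frequently_atTop.2 fun b => ?_))
  obtain ⟨b', hb'⟩ := eventually_atTop.1 hM0
  obtain ⟨j, hj, hjb, hjb', hjc⟩ := (hxj.and <| (eventually_ge_atTop b).and <|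
    (eventually_ge_atTop b').and <| eventually_ge_atTop ⌈c⌉₊).exists
  obtain ⟨N, hNj, hN⟩ := not_not.1 hj
  refine ⟨N, hjb.trans hNj, ?_⟩
  have hMN := hb' N (hjb'.trans hNj)
  rw [EReal.coe_le_coe_iff, le_div_iff₀ hMN]
  have hcj : c ≤ j := (Nat.le_ceil c).trans (by exact_mod_cast hjc)
  calc (c + 1) * M N ≤ (j + 1) * M N := by gcongr
    _ ≤ _ := hN
    _ ≤ _ := Finset.sum_le_sum fun n _ => by
      rw [← ENNReal.ofReal_le_iff_le_toReal (hx n).ne]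
      exact ENNReal.le_tsum j

end

theorem measurePreserving_zpow {X : Type*} [MeasurableSpace X] {μ : Measure X} {T : X ≃ᵐ X}
    (hT : MeasurePreserving T μ μ) (n : ℤ) :
    MeasurePreserving (⇑((T.toEquiv : Equiv.Perm X) ^ n)) μ μ := by
  have hiter : ∀ (e : Equiv.Perm X) (k : ℕ), ⇑(e ^ k) = (⇑e)^[k] := fun e k => by
    rw [Equiv.Perm.iterate_eq_pow]
  rcases n with k | k
  · rw [Int.ofNat_eq_natCast, zpow_natCast, hiter]
    exact hT.iterate k
  · rw [zpow_negSucc, ← inv_pow, hiter]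
    exact (hT.symm T).iterate (k + 1)

theorem theoremA {X : Type*} [MeasurableSpace X] (μ : Measure X) :
    -- (1) for a measure-preserving `T`, not necessarily invertible, and times in `ℕ`
    (∀ T : X → X, MeasurePreserving T μ μ → ∀ a : ℕ → ℕ, ∀ f : X → ℝ, Integrable f μ →
      ∀ᵐ x ∂μ, Tendsto
        (fun N : ℕ => (∑ n ∈ Finset.Icc 1 N, f (T^[a n] x)) / iterLogProd (N : ℝ))
        atTop (𝓝 0)) ∧
    -- (1) for an invertible measure-preserving `T` and times in `ℤ`
    (∀ T : X ≃ᵐ X, MeasurePreserving T μ μ → ∀ a : ℕ → ℤ, ∀ f : X → ℝ, Integrable f μ →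
      ∀ᵐ x ∂μ, Tendsto
        (fun N : ℕ => (∑ n ∈ Finset.Icc 1 N, f (((T.toEquiv : Equiv.Perm X) ^ a n) x)) /
          iterLogProd (N : ℝ))
        atTop (𝓝 0)) ∧
    -- (2) sharpness, in every aperiodic system on a (countably separated) probability space
    (∀ [IsProbabilityMeasure μ] [MeasurableSpace.CountablySeparated X],
      ∀ T : X → X, MeasurePreserving T μ μ → IsAperiodic T μ →
      ∀ M : ℕ → ℝ, (∀ᶠ N in atTop, 0 < M N) →
      Tendsto (fun N : ℕ => M N / iterLogProd (N : ℝ)) atTop (𝓝 0) →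
      (∃ (f : X → ℝ) (a : ℕ → ℕ), Integrable f μ ∧
        ∀ᵐ x ∂μ, limsup
          (fun N : ℕ => (((∑ n ∈ Finset.Icc 1 N, f (T^[a n] x)) / M N : ℝ) : EReal))
          atTop = ⊤) ∧
      -- the sequence of times may be taken to be `2 ^ n`
      (∃ f : X → ℝ, Integrable f μ ∧
        ∀ᵐ x ∂μ, limsup
          (fun N : ℕ => (((∑ n ∈ Finset.Icc 1 N, f (T^[2 ^ n] x)) / M N : ℝ) : EReal))
          atTop = ⊤)) := by
  refine ⟨fun T hT a f hf => ?_, fun T hT a f hf => ?_, fun T hT ha M hM0 hM => ?_⟩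
  · exact ae_tendsto_sum_div_iterLogProd (fun n => hT.iterate (a n)) hf
  · exact ae_tendsto_sum_div_iterLogProd (fun n => measurePreserving_zpow hT (a n)) hf
  · obtain ⟨f, hf, h⟩ := exists_limsup_sum_two_pow_eq_top hT ha hM0 hM
    exact ⟨⟨f, fun n => 2 ^ n, hf, h⟩, f, hf, h⟩
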